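/- Let $H$ be an infinite-dimensional separable complex Hilbert space with inner product $\langle\cdot,\cdot\rangle$ (linear in the first variable) and a fixed orthonormal basis $(e_n)_{n\ge 1}$. Let $\Lambda=(\lambda_n)_{n\ge 1}$ be a bounded sequence in $\mathbb{C}$, let $D_\Lambda$ be the bounded diagonal operator with $D_\Lambda e_n=\lambda_n e_n$, let $u=\sum_n\alpha_n e_n$ and $v=\sum_n\beta_n e_n$ be non-zero vectors of $H$, and let $T=D_\Lambda+u\otimes v$, where $(u\otimes v)(h)=\langle h,v\rangle u$. Assume that $T$ belongs to the class $(RO)$: (i) $\alpha_n\beta_n\neq 0$ for every $n$; (ii) $n\mapsto\lambda_n$ is injective; (iii) the derived set (set of accumulation points) of $\{\lambda_n : n\ge 1\}$ is not a singleton. Assume that the spectrum $\sigma(T)$ is connected and is not contained in any vertical line $\{z:\operatorname{Re} z=c\}$, and that neither $T$ nor its Hilbert space adjoint $T^*$ has an eigenvalue. Let $a=\min_{\lambda\in\sigma(T)}\operatorname{Re}\lambda$ and $b=\max_{\lambda\in\sigma(T)}\operatorname{Re}\lambda$, and let $$\Omega(T)=\Big\{x\in \operatorname{Re}(\sigma(T))\cap(a,b)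 : \sum_{n}\Big(\frac{|\alpha_n|^2}{|\operatorname{Re}\lambda_n-x|}+\frac{|\beta_n|^2}{|\operatorname{Re}\lambda_n-x|}\Big)<\infty\Big\},$$ where the sum counts as infinite if $\operatorname{Re}\lambda_n=x$ for some $n$. Put $f_T(z)=\sum_n \dfrac{\alpha_n\overline{\beta_n}}{\lambda_n-z}$ wherever the series converges; it converges absolutely when $\operatorname{Re} z\in\Omega(T)$. For $h\in H$ let $\rho_T(h)$ be the union of all open sets $U\subseteq\mathbb{C}$ on which there is a holomorphic function $g:U\to H$ with $(T-zI)g(z)=h$ for all $z\in U$, let $\sigma_T(h)=\mathbb{C}\setminus\rho_T(h)$, and for $F\subseteq\mathbb{C}$ let $H_T(F)=\{h\in H:\sigma_T(h)\subseteq F\}$, a linear subspace of $H$ that need not be closed. Let $x\in\Omega(T)$ be such that $1+f_T(x+iy)\neq 0$ for every $y\in\mathbb{R}$ with $x+iy\in\sigma(T)$, and put $$F_x^+=\{\lambda\in\sigma(T):\operatorname{Re}\lambda\ge x\},\qquad F_x^-=\{\lambda\in\sigma(T):\operatorname{Re}\lambda\le x\}.$$ Then the local spectral subspaces $H_T(F_x^+)$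 and $H_T(F_x^-)$ are both non-zero. -/

import Mathlib

open scoped ENNReal InnerProductSpace

noncomputable section

namespace RankOnePerturbation

variable {H : Type*} [NormedAddCommGroup H] [InnerProductSpace ℂ H]

theorem memlp_mul {Λ : ℕ → ℂ} {C : ℝ} (hC : ∀ n, ‖Λ n‖ ≤ C) (f : lp (fun _ : ℕ => ℂ) 2) :
    Memℓp (fun n => Λ n * f n) 2 := by
  refine Memℓp.mono (g := fun n => C * ‖f n‖) ((lp.memℓp f).norm.const_mul C) fun n => ?_
  rw [norm_mul]
  exact mul_le_mul_of_nonneg_right (hC n) (norm_nonneg _)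

/-- Multiplication by a bounded sequence `Λ`, as a bounded operator on `ℓ²(ℕ)`. -/
def mulOp (Λ : ℕ → ℂ) (C : ℝ) (hC : ∀ n, ‖Λ n‖ ≤ C) :
    lp (fun _ : ℕ => ℂ) 2 →L[ℂ] lp (fun _ : ℕ => ℂ) 2 :=
  LinearMap.mkContinuous
    { toFun := fun f => ⟨fun n => Λ n * f n, memlp_mul hC f⟩
      map_add' := fun f g => by
        ext n
        simp only [mul_add, lp.coeFn_add, Pi.add_apply]
      map_smul' := fun c f => by
        ext n
        simp [mul_left_comm] }
    C
    (fun f => by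
      have hC0 : 0 ≤ C := (norm_nonneg _).trans (hC 0)
      have h : ‖(⟨fun n => Λ n * f n, memlp_mul hC f⟩ : lp (fun _ : ℕ => ℂ) 2)‖
          ≤ ‖(C : ℂ) • f‖ := by
        refine lp.norm_mono (by norm_num) fun n => ?_
        simp only [lp.coeFn_smul, Pi.smul_apply, norm_mul, smul_eq_mul, Complex.norm_real,
          Real.norm_of_nonneg hC0]
        exact mul_le_mul_of_nonneg_right (hC n) (norm_nonneg _)
      rw [norm_smul, Complex.norm_real, Real.norm_of_nonneg hC0] at h
      exact h)

theorem exists_norm_bound {Λ : ℕ → ℂ} (hΛ : Bornology.IsBounded (Set.range Λ)) :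
    ∃ C : ℝ, ∀ n, ‖Λ n‖ ≤ C := by
  obtain ⟨C, hC⟩ := hΛ.exists_norm_le
  exact ⟨C, fun n => hC _ ⟨n, rfl⟩⟩

/-- The diagonal operator `D_Λ` with respect to the orthonormal basis `e`: in coordinates it
multiplies the `n`-th coefficient by `Λ n`, so that `D_Λ (e n) = Λ n • e n`. -/
def diagonalOp (e : HilbertBasis ℕ ℂ H) (Λ : ℕ → ℂ) (hΛ : Bornology.IsBounded (Set.range Λ)) :
    H →L[ℂ] H :=
  (e.repr.symm.toContinuousLinearEquiv : lp (fun _ : ℕ => ℂ) 2 →L[ℂ] H) ∘L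
    (mulOp Λ (exists_norm_bound hΛ).choose (exists_norm_bound hΛ).choose_spec) ∘L
      (e.repr.toContinuousLinearEquiv : H →L[ℂ] lp (fun _ : ℕ => ℂ) 2)

theorem repr_diagonalOp (e : HilbertBasis ℕ ℂ H) (Λ : ℕ → ℂ)
    (hΛ : Bornology.IsBounded (Set.range Λ)) (x : H) (n : ℕ) :
    e.repr (diagonalOp e Λ hΛ x) n = Λ n * e.repr x n := by
  simp [diagonalOp, mulOp]

theorem diagonalOp_basis (e : HilbertBasis ℕ ℂ H) (Λ : ℕ → ℂ)
    (hΛ : Bornology.IsBounded (Set.range Λ)) (n : ℕ) :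
    diagonalOp e Λ hΛ (e n) = Λ n • e n := by
  apply e.repr.injective
  ext m
  rw [repr_diagonalOp, map_smul, e.repr_self]
  by_cases h : m = n
  · subst h; simp
  · simp [h]

/-- The rank-one perturbation `T = D_Λ + u ⊗ v`, where `(u ⊗ v) x = ⟨x, v⟩ u`
(inner product linear in the first slot; in Mathlib's convention this is `⟪v, x⟫_ℂ • u`). -/
def perturbedOp (e : HilbertBasis ℕ ℂ H) (Λ : ℕ → ℂ) (hΛ : Bornology.IsBounded (Set.range Λ))
    (u v : H) : H →L[ℂ] H :=
  diagonalOp e Λ hΛ + InnerProductSpace.rankOne ℂ u v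

theorem perturbedOp_apply (e : HilbertBasis ℕ ℂ H) (Λ : ℕ → ℂ)
    (hΛ : Bornology.IsBounded (Set.range Λ)) (u v x : H) :
    perturbedOp e Λ hΛ u v x = diagonalOp e Λ hΛ x + ⟪v, x⟫_ℂ • u := by
  simp [perturbedOp]

/-- Membership of `D_Λ + u ⊗ v` in the class `(RO)`; the coefficients of `u` and `v` in the
basis `e` are `α n = e.repr u n` and `β n = e.repr v n`. -/
structure IsRO (e : HilbertBasis ℕ ℂ H) (Λ : ℕ → ℂ) (u v : H) : Prop where
  bounded : Bornology.IsBounded (Set.range Λ)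
  left_ne_zero : u ≠ 0
  right_ne_zero : v ≠ 0
  coeff_ne_zero : ∀ n, e.repr u n * e.repr v n ≠ 0
  injective : Function.Injective Λ
  derivedSet_not_singleton : ¬ ∃ z : ℂ, derivedSet (Set.range Λ) = {z}

/-- The Borel series `f_T(z) = ∑ α_n conj(β_n) / (λ_n - z)`. -/
def borelSeries (e : HilbertBasis ℕ ℂ H) (Λ : ℕ → ℂ) (u v : H) (z : ℂ) : ℂ :=
  ∑' n, e.repr u n * (starRingEnd ℂ) (e.repr v n) / (Λ n - z)

/-- The point spectrum (set of eigenvalues) of a bounded operator. -/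
def pointSpectrum (T : H →L[ℂ] H) : Set ℂ :=
  {z | Module.End.HasEigenvalue (T : Module.End ℂ H) z}

/-- The relevant set `Ω(T)` of `T = D_Λ + u ⊗ v`: the points `x` of `Re σ(T)` strictly between the
minimum and the maximum of `Re σ(T)` such that
`∑ |α_n|² / |Re λ_n - x| + |β_n|² / |Re λ_n - x|` is finite. As `α_n β_n ≠ 0`, finiteness of the
sum entails that no denominator vanishes; this is said explicitly because division by `0` gives
`0` here. -/
def relevantSet (e : HilbertBasis ℕ ℂ H) (Λ : ℕ → ℂ) (hΛ : Bornology.IsBounded (Set.range Λ))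
    (u v : H) : Set ℝ :=
  {x | x ∈ Complex.re '' spectrum ℂ (perturbedOp e Λ hΛ u v) ∧
    sInf (Complex.re '' spectrum ℂ (perturbedOp e Λ hΛ u v)) < x ∧
    x < sSup (Complex.re '' spectrum ℂ (perturbedOp e Λ hΛ u v)) ∧
    (∀ n, (Λ n).re ≠ x) ∧
    Summable fun n => ‖e.repr u n‖ ^ 2 / |(Λ n).re - x| + ‖e.repr v n‖ ^ 2 / |(Λ n).re - x|}

/-- The local resolvent set `ρ_T(x)`: the union of all open sets `U` on which
`(T - z) f(z) = x` has a holomorphic solution `f : U → H`. -/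
def localResolvent (T : H →L[ℂ] H) (x : H) : Set ℂ :=
  ⋃₀ {U | IsOpen U ∧ ∃ f : ℂ → H, DifferentiableOn ℂ f U ∧ ∀ z ∈ U, T (f z) - z • f z = x}

/-- The local spectrum `σ_T(x)`. -/
def localSpectrum (T : H →L[ℂ] H) (x : H) : Set ℂ :=
  (localResolvent T x)ᶜ

theorem localSpectrum_zero (T : H →L[ℂ] H) : localSpectrum T 0 = ∅ := by
  rw [localSpectrum, Set.compl_empty_iff, Set.eq_univ_iff_forall]
  exact fun z => ⟨Set.univ, ⟨isOpen_univ, fun _ => 0, differentiableOn_const 0, by simp⟩, trivial⟩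

theorem localSpectrum_add (T : H →L[ℂ] H) (x y : H) :
    localSpectrum T (x + y) ⊆ localSpectrum T x ∪ localSpectrum T y := by
  rw [localSpectrum, localSpectrum, localSpectrum, ← Set.compl_inter]
  refine Set.compl_subset_compl.mpr ?_
  rintro z ⟨⟨U, ⟨hU, f, hf, hfx⟩, hzU⟩, ⟨V, ⟨hV, g, hg, hgy⟩, hzV⟩⟩
  refine ⟨U ∩ V, ⟨hU.inter hV, fun w => f w + g w,
    (hf.mono Set.inter_subset_left).add (hg.mono Set.inter_subset_right), fun w hw => ?_⟩,
    ⟨hzU, hzV⟩⟩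
  rw [← hfx w hw.1, ← hgy w hw.2, map_add, smul_add]
  abel

theorem localSpectrum_smul (T : H →L[ℂ] H) (c : ℂ) (x : H) :
    localSpectrum T (c • x) ⊆ localSpectrum T x := by
  refine Set.compl_subset_compl.mpr ?_
  rintro z ⟨U, ⟨hU, f, hf, hfx⟩, hzU⟩
  refine ⟨U, ⟨hU, fun w => c • f w, hf.const_smul c, fun w hw => ?_⟩, hzU⟩
  rw [← hfx w hw, map_smul, smul_sub, smul_comm]

/-- The local spectral subspace `H_T(F) = {x : σ_T(x) ⊆ F}`, a linear manifold of `H`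
(not necessarily closed). -/
def spectralSubspace (T : H →L[ℂ] H) (F : Set ℂ) : Submodule ℂ H where
  carrier := {x | localSpectrum T x ⊆ F}
  add_mem' := fun {x y} hx hy => (localSpectrum_add T x y).trans (Set.union_subset hx hy)
  zero_mem' := by simp [localSpectrum_zero]
  smul_mem' := fun c x hx => (localSpectrum_smul T c x).trans hx

/-- `F_x^+`, the part of the spectrum in the half-plane `Re ≥ x`. -/
def rightPart (T : H →L[ℂ] H) (x : ℝ) : Set ℂ := {z ∈ spectrum ℂ T | x ≤ z.re}

/-- `F_x^-`, the part of the spectrum in the half-plane `Re ≤ x`. -/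
def leftPart (T : H →L[ℂ] H) (x : ℝ) : Set ℂ := {z ∈ spectrum ℂ T | z.re ≤ x}

end RankOnePerturbation

end

noncomputable section

namespace RankOnePerturbation

open MeasureTheory Filter Topology Complex BoundedContinuousFunction

/-! A Riesz projection along the line `Re z = x` is applied to a basis vector `e m` with `x < (Λ
m).re`. Formally `(T - z)⁻¹ e_m = (λ_m - z)⁻¹ (e_m - conj β_m (1 + f_T(z))⁻¹ (D_Λ - z)⁻¹ u)`, and
only the last term needs integrating. The line may cross the spectrum, but Cauchy-Schwarz bounds the
integral of `|λ_m - z|⁻¹ |λ_n - z|⁻¹` by a multiple of `|Re λ_n - x|^(-1/2)`, so the condition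
defining `Ω(T)` puts the integral in `H` (`lineTransform`). Inserting a Cauchy kernel with pole `w`
off the line gives local resolvents (`perturbedOp_lineTransform`). The leftover multiple of `u`
vanishes for `w` on the right and has a closed form on the left, so `e m` is a sum of vectors with
local spectra in the right and left parts (`exists_add_eq_basis`). If one summand were zero, the
local spectrum of `e m` would lie on one side. It contains the whole derived set of the `Λ n`
(`mem_localSpectrum_of_mem_derivedSet`), which contains `σ(T)` (`spectrum_subset_derivedSet`), and
`σ(T)` has points strictly on both sides. -/

/-! ### Integrals of products of two Cauchy kernels over the line. -/

theorem norm_sub_mul_I_sq (a : ℂ) (y : ℝ) : ‖a - y * I‖ ^ 2 = a.re ^ 2 + (y - a.im) ^ 2 := by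
  rw [Complex.sq_norm, Complex.normSq_apply]
  simp
  ring

theorem sub_mul_I_ne_zero {a : ℂ} (ha : a.re ≠ 0) (y : ℝ) : a - y * I ≠ 0 := by
  intro h
  apply ha
  simpa using congrArg Complex.re h

theorem abs_re_le_norm_sub_mul_I (a : ℂ) (y : ℝ) : |a.re| ≤ ‖a - y * I‖ := by
  simpa using Complex.abs_re_le_norm (a - y * I)

theorem norm_inv_sub_mul_I_le {a : ℂ} (ha : a.re ≠ 0) (y : ℝ) : ‖(a - y * I)⁻¹‖ ≤ |a.re|⁻¹ := by
  rw [norm_inv]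
  exact inv_anti₀ (abs_pos.2 ha) (abs_re_le_norm_sub_mul_I a y)

theorem continuous_inv_sub_mul_I {a : ℂ} (ha : a.re ≠ 0) :
    Continuous fun y : ℝ => (a - y * I)⁻¹ :=
  (by fun_prop : Continuous fun y : ℝ => a - y * I).inv₀ (sub_mul_I_ne_zero ha)

theorem norm_inv_sub_mul_I_sq {a : ℂ} (ha : a.re ≠ 0) (y : ℝ) :
    ‖(a - y * I)⁻¹‖ ^ 2 = (a.re ^ 2)⁻¹ * (1 + ((y - a.im) / a.re) ^ 2)⁻¹ := by
  rw [norm_inv, inv_pow, norm_sub_mul_I_sq, ← mul_inv]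
  congr 1
  field_simp

theorem integrable_norm_inv_sub_mul_I_sq {a : ℂ} (ha : a.re ≠ 0) :
    Integrable fun y : ℝ => ‖(a - y * I)⁻¹‖ ^ 2 := by
  simp_rw [norm_inv_sub_mul_I_sq ha]
  exact ((integrable_inv_one_add_sq.comp_div ha).comp_sub_right a.im).const_mul _

theorem integral_norm_inv_sub_mul_I_sq {a : ℂ} (ha : a.re ≠ 0) :
    ∫ y : ℝ, ‖(a - y * I)⁻¹‖ ^ 2 = Real.pi / |a.re| := by
  simp_rw [norm_inv_sub_mul_I_sq ha]
  rw [integral_const_mul, integral_sub_right_eq_self (fun y : ℝ => (1 + (y / a.re) ^ 2)⁻¹) a.im,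
    Measure.integral_comp_div (fun y : ℝ => (1 + y ^ 2)⁻¹) a.re, integral_univ_inv_one_add_sq,
    ← sq_abs, smul_eq_mul]
  have := abs_pos.2 ha
  field_simp

theorem norm_inv_mul_inv_le {a b : ℂ} {κ : ℝ} (hκ : 0 < κ) (y : ℝ) :
    ‖(a - y * I)⁻¹ * (b - y * I)⁻¹‖ ≤
      2⁻¹ * (κ * ‖(a - y * I)⁻¹‖ ^ 2 + κ⁻¹ * ‖(b - y * I)⁻¹‖ ^ 2) := by
  rw [norm_mul]
  set s := ‖(a - y * I)⁻¹‖
  set t := ‖(b - y * I)⁻¹‖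
  have h : 0 ≤ κ⁻¹ * (κ * s - t) ^ 2 := by positivity
  have h2 : κ⁻¹ * (κ * s - t) ^ 2 = κ * s ^ 2 - 2 * (s * t) + κ⁻¹ * t ^ 2 := by
    field_simp
    ring
  linarith

theorem integrable_inv_mul_inv {a b : ℂ} (ha : a.re ≠ 0) (hb : b.re ≠ 0) :
    Integrable fun y : ℝ => (a - y * I)⁻¹ * (b - y * I)⁻¹ :=
  (((integrable_norm_inv_sub_mul_I_sq ha).const_mul 1).add
    ((integrable_norm_inv_sub_mul_I_sq hb).const_mul 1⁻¹) |>.const_mul 2⁻¹).mono'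
    ((continuous_inv_sub_mul_I ha).mul (continuous_inv_sub_mul_I hb)).aestronglyMeasurable
    (Eventually.of_forall fun y => norm_inv_mul_inv_le one_pos y)

/-- Cauchy-Schwarz, as weighted AM-GM with the optimal weight `κ = √|a.re| / √|b.re|`. The power
`|b.re|^(-1/2)` is what matches the square-summability in `Ω(T)`. -/
theorem integral_norm_inv_mul_inv_le {a b : ℂ} (ha : a.re ≠ 0) (hb : b.re ≠ 0) :
    ∫ y : ℝ, ‖(a - y * I)⁻¹ * (b - y * I)⁻¹‖ ≤ Real.pi / (√|a.re| * √|b.re|) := by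
  have hA : 0 < √|a.re| := Real.sqrt_pos.2 (abs_pos.2 ha)
  have hB : 0 < √|b.re| := Real.sqrt_pos.2 (abs_pos.2 hb)
  have hκ : 0 < √|a.re| / √|b.re| := div_pos hA hB
  have h1 := (integrable_norm_inv_sub_mul_I_sq ha).const_mul (√|a.re| / √|b.re|)
  have h2 := (integrable_norm_inv_sub_mul_I_sq hb).const_mul (√|a.re| / √|b.re|)⁻¹
  calc ∫ y : ℝ, ‖(a - y * I)⁻¹ * (b - y * I)⁻¹‖
      ≤ ∫ y : ℝ, 2⁻¹ * (√|a.re| / √|b.re| * ‖(a - y * I)⁻¹‖ ^ 2 +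
          (√|a.re| / √|b.re|)⁻¹ * ‖(b - y * I)⁻¹‖ ^ 2) :=
        integral_mono (integrable_inv_mul_inv ha hb).norm ((h1.add h2).const_mul _)
          fun y => norm_inv_mul_inv_le hκ y
    _ = Real.pi / (√|a.re| * √|b.re|) := by
        rw [integral_const_mul, integral_add h1 h2, integral_const_mul, integral_const_mul,
          integral_norm_inv_sub_mul_I_sq ha, integral_norm_inv_sub_mul_I_sq hb]
        have hA2 : |a.re| = √|a.re| ^ 2 := (Real.sq_sqrt (abs_nonneg _)).symm
        have hB2 : |b.re| = √|b.re| ^ 2 := (Real.sq_sqrt (abs_nonneg _)).symm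
        set A := √|a.re|
        set B := √|b.re|
        rw [hA2, hB2]
        field_simp
        ring

theorem tendsto_log_sub_mul_I_atTop (a : ℂ) :
    Tendsto (fun y : ℝ => Complex.log (a - y * I) - Real.log y) atTop (𝓝 (-(Real.pi / 2) * I)) := by
  have h0 : Tendsto (fun y : ℝ => a / y - I) atTop (𝓝 (-I)) := by
    have : Tendsto (fun y : ℝ => a / (y : ℂ)) atTop (𝓝 0) := by
      rw [tendsto_zero_iff_norm_tendsto_zero]
      simp only [norm_div, Complex.norm_real]
      exact tendsto_const_nhds.div_atTop tendsto_norm_atTop_atTop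
    simpa using this.sub_const I
  have h1 := (continuousAt_clog (x := -I) (by simp [slitPlane])).tendsto.comp h0
  rw [Complex.log_neg_I] at h1
  refine (h1.congr' ?_).trans (by simp)
  filter_upwards [eventually_gt_atTop 0, h0.eventually_ne (b₂ := 0) (by simp)] with y hy hne
  have hy' : (y : ℂ) ≠ 0 := by exact_mod_cast hy.ne'
  have : a - y * I = y * (a / y - I) := by field_simp
  rw [this, Complex.log_ofReal_mul hy hne]
  simp

theorem tendsto_log_add_mul_I_atTop (a : ℂ) :
    Tendsto (fun y : ℝ => Complex.log (a + y * I) - Real.log y) atTop (𝓝 (Real.pi / 2 * I)) := by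
  have h0 : Tendsto (fun y : ℝ => a / y + I) atTop (𝓝 I) := by
    have : Tendsto (fun y : ℝ => a / (y : ℂ)) atTop (𝓝 0) := by
      rw [tendsto_zero_iff_norm_tendsto_zero]
      simp only [norm_div, Complex.norm_real]
      exact tendsto_const_nhds.div_atTop tendsto_norm_atTop_atTop
    simpa using this.add_const I
  have h1 := (continuousAt_clog (x := I) (by simp [slitPlane])).tendsto.comp h0
  rw [Complex.log_I] at h1
  refine h1.congr' ?_
  filter_upwards [eventually_gt_atTop 0, h0.eventually_ne (b₂ := 0) (by simp)] with y hy hne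
  have hy' : (y : ℂ) ≠ 0 := by exact_mod_cast hy.ne'
  have : a + y * I = y * (a / y + I) := by field_simp
  rw [this, Complex.log_ofReal_mul hy hne]
  simp

theorem hasDerivAt_log_sub_mul_I {a : ℂ} (ha : 0 < a.re) (y : ℝ) :
    HasDerivAt (fun y : ℝ => Complex.log (a - y * I)) (-I * (a - y * I)⁻¹) y := by
  have h : HasDerivAt (fun y : ℝ => a - y * I) (-I) y := by
    simpa using ((hasDerivAt_id y).ofReal_comp.mul_const I).const_sub a
  simpa [div_eq_mul_inv] using h.clog_real (Or.inl (by simpa using ha))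

theorem hasDerivAt_log_add_mul_I {a : ℂ} (ha : 0 < a.re) (y : ℝ) :
    HasDerivAt (fun y : ℝ => Complex.log (a + y * I)) (I * (a + y * I)⁻¹) y := by
  have h : HasDerivAt (fun y : ℝ => a + y * I) I y := by
    simpa using ((hasDerivAt_id y).ofReal_comp.mul_const I).const_add a
  simpa [div_eq_mul_inv] using h.clog_real (Or.inl (by simpa using ha))

theorem tendsto_inv_sub_mul_I {l : Filter ℝ} (hl : Tendsto (fun y : ℝ => |y|) l atTop) (a : ℂ) :
    Tendsto (fun y : ℝ => (a - y * I)⁻¹) l (𝓝 0) := by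
  refine tendsto_inv₀_cobounded.comp (tendsto_norm_atTop_iff_cobounded.1 ?_)
  refine tendsto_atTop_mono (f := fun y : ℝ => |y| - ‖a‖) (fun y => ?_)
    (tendsto_atTop_add_const_right _ _ hl)
  have := norm_sub_norm_le ((y : ℂ) * I) a
  rw [norm_sub_rev] at this
  simpa using this

/-- Both poles lie on the same side. The logarithms of `a - iy` and `b - iy` stay on the principal
branch, and their difference tends to 0 at both ends. -/
theorem integral_inv_mul_inv_of_pos {a b : ℂ} (ha : 0 < a.re) (hb : 0 < b.re) :
    ∫ y : ℝ, (a - y * I)⁻¹ * (b - y * I)⁻¹ = 0 := by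
  by_cases hab : a = b
  · subst hab
    have hd : ∀ y : ℝ, HasDerivAt (fun y : ℝ => -I * (a - y * I)⁻¹)
        ((a - y * I)⁻¹ * (a - y * I)⁻¹) y := fun y => by
      have h : HasDerivAt (fun y : ℝ => a - y * I) (-I) y := by
        simpa using ((hasDerivAt_id y).ofReal_comp.mul_const I).const_sub a
      have hne := sub_mul_I_ne_zero ha.ne' y
      refine ((h.fun_inv hne).const_mul (-I)).congr_deriv ?_
      rw [div_eq_mul_inv, ← inv_pow]
      linear_combination (-((a - y * I)⁻¹) ^ 2) * I_sq
    have h1 := (tendsto_inv_sub_mul_I tendsto_abs_atBot_atTop a).const_mul (-I)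
    have h2 := (tendsto_inv_sub_mul_I tendsto_abs_atTop_atTop a).const_mul (-I)
    simpa using integral_of_hasDerivAt_of_tendsto hd (integrable_inv_mul_inv ha.ne' ha.ne') h1 h2
  · have hba : b - a ≠ 0 := sub_ne_zero.2 (Ne.symm hab)
    have hd : ∀ y : ℝ, HasDerivAt
        (fun y : ℝ => (b - a)⁻¹ * (I * (Complex.log (a - y * I) - Complex.log (b - y * I))))
        ((a - y * I)⁻¹ * (b - y * I)⁻¹) y := fun y => by
      have hA := sub_mul_I_ne_zero ha.ne' y
      have hB := sub_mul_I_ne_zero hb.ne' y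
      refine ((((hasDerivAt_log_sub_mul_I ha y).sub
        (hasDerivAt_log_sub_mul_I hb y)).const_mul I).const_mul (b - a)⁻¹).congr_deriv ?_
      have key : (a - y * I)⁻¹ - (b - y * I)⁻¹ =
          (b - a) * ((a - y * I)⁻¹ * (b - y * I)⁻¹) := by
        field_simp
        ring
      linear_combination -(b - a)⁻¹ * ((a - y * I)⁻¹ - (b - y * I)⁻¹) * I_sq + (b - a)⁻¹ * key +
        ((a - y * I)⁻¹ * (b - y * I)⁻¹) * inv_mul_cancel₀ hba
    have h2 : Tendsto (fun y : ℝ => (b - a)⁻¹ *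
        (I * (Complex.log (a - y * I) - Complex.log (b - y * I)))) atTop (𝓝 0) := by
      simpa using (((tendsto_log_sub_mul_I_atTop a).sub
        (tendsto_log_sub_mul_I_atTop b)).const_mul I).const_mul (b - a)⁻¹
    have h1 : Tendsto (fun y : ℝ => (b - a)⁻¹ *
        (I * (Complex.log (a - y * I) - Complex.log (b - y * I)))) atBot (𝓝 0) := by
      -- Substituting `y ↦ -y` turns the limit at `-∞` into one at `+∞`.
      simpa [Function.comp_def, ← sub_eq_add_neg] using ((((tendsto_log_add_mul_I_atTop a).sub
        (tendsto_log_add_mul_I_atTop b)).const_mul I).const_mul (b - a)⁻¹).comp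
          tendsto_neg_atBot_atTop
    simpa using integral_of_hasDerivAt_of_tendsto hd (integrable_inv_mul_inv ha.ne' hb.ne') h1 h2

/-- Now `b - iy` has negative real part, so the primitive uses `log (-b + iy)` to stay on the
principal branch. Its limits at the two ends are opposite, and their difference is the residue. -/
theorem integral_inv_mul_inv_of_pos_of_neg {a b : ℂ} (ha : 0 < a.re) (hb : b.re < 0) :
    ∫ y : ℝ, (a - y * I)⁻¹ * (b - y * I)⁻¹ = -(2 * Real.pi / (a - b)) := by
  have hab : a - b ≠ 0 := fun h => by
    have := congrArg Complex.re h
    simp at this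
    linarith
  have hd : ∀ y : ℝ, HasDerivAt
      (fun y : ℝ => -(a - b)⁻¹ * (I * (Complex.log (a - y * I) - Complex.log (-b + y * I))))
      ((a - y * I)⁻¹ * (b - y * I)⁻¹) y := fun y => by
    have hA := sub_mul_I_ne_zero ha.ne' y
    have hB := sub_mul_I_ne_zero hb.ne y
    have hB' : -b + y * I ≠ 0 := fun h => hB (by linear_combination -h)
    refine ((((hasDerivAt_log_sub_mul_I ha y).sub (hasDerivAt_log_add_mul_I
      (a := -b) (by simpa using hb) y)).const_mul I).const_mul (-(a - b)⁻¹)).congr_deriv ?_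
    rw [show -b + y * I = -(b - y * I) by ring, inv_neg]
    have key : (a - y * I)⁻¹ - (b - y * I)⁻¹ =
        -(a - b) * ((a - y * I)⁻¹ * (b - y * I)⁻¹) := by
      field_simp
      ring
    linear_combination (a - b)⁻¹ * ((a - y * I)⁻¹ - (b - y * I)⁻¹) * I_sq - (a - b)⁻¹ * key +
      ((a - y * I)⁻¹ * (b - y * I)⁻¹) * inv_mul_cancel₀ hab
  have h2 : Tendsto (fun y : ℝ => -(a - b)⁻¹ *
      (I * (Complex.log (a - y * I) - Complex.log (-b + y * I)))) atTop
      (𝓝 (-(a - b)⁻¹ * Real.pi)) := by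
    have := (((tendsto_log_sub_mul_I_atTop a).sub
      (tendsto_log_add_mul_I_atTop (-b))).const_mul I).const_mul (-(a - b)⁻¹)
    convert this using 2
    · simp
    · linear_combination -(a - b)⁻¹ * Real.pi * I_sq
  have h1 : Tendsto (fun y : ℝ => -(a - b)⁻¹ *
      (I * (Complex.log (a - y * I) - Complex.log (-b + y * I)))) atBot
      (𝓝 (-(a - b)⁻¹ * -Real.pi)) := by
    have := ((((tendsto_log_add_mul_I_atTop a).sub
      (tendsto_log_sub_mul_I_atTop (-b))).const_mul I).const_mul (-(a - b)⁻¹)).comp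
        tendsto_neg_atBot_atTop
    convert this using 2
    · simp [← sub_eq_add_neg]
    · linear_combination (a - b)⁻¹ * Real.pi * I_sq
  rw [integral_of_hasDerivAt_of_tendsto hd (integrable_inv_mul_inv ha.ne' hb.ne) h1 h2]
  field_simp
  ring

variable {H : Type*} [NormedAddCommGroup H] [InnerProductSpace ℂ H]

/-! ### Coordinates, the spectrum, and local spectra of basis vectors. -/

theorem repr_perturbedOp (e : HilbertBasis ℕ ℂ H) (Λ : ℕ → ℂ)
    (hΛ : Bornology.IsBounded (Set.range Λ)) (u v h : H) (n : ℕ) :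
    e.repr (perturbedOp e Λ hΛ u v h) n = Λ n * e.repr h n + ⟪v, h⟫_ℂ * e.repr u n := by
  rw [perturbedOp_apply, map_add, map_smul, lp.coeFn_add, Pi.add_apply, repr_diagonalOp]
  simp

theorem repr_basis (e : HilbertBasis ℕ ℂ H) (m n : ℕ) :
    e.repr (e m) n = if n = m then 1 else 0 := by
  rw [e.repr_self]
  by_cases h : n = m
  · subst h; simp
  · simp [h]

theorem hasSum_conj_mul_repr (e : HilbertBasis ℕ ℂ H) (v h : H) :
    HasSum (fun n => (starRingEnd ℂ) (e.repr v n) * e.repr h n) ⟪v, h⟫_ℂ := by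
  have := lp.hasSum_inner (𝕜 := ℂ) (e.repr v) (e.repr h)
  rw [e.repr.inner_map_map] at this
  simpa [mul_comm] using this

theorem inner_basis_right (e : HilbertBasis ℕ ℂ H) (v : H) (m : ℕ) :
    ⟪v, e m⟫_ℂ = (starRingEnd ℂ) (e.repr v m) := by
  rw [e.repr_apply_apply, inner_conj_symm]

/-- Solving for the coordinates of `g` and pairing with `v` gives `(1 + f_T(z)) ⟪v, g⟫ = conj β_m /
(λ_m - z)`, whose right side is nonzero. -/
theorem one_add_borelSeries_ne_zero (e : HilbertBasis ℕ ℂ H) (Λ : ℕ → ℂ)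
    (hΛ : Bornology.IsBounded (Set.range Λ)) (u v : H) {z : ℂ} (hz : ∀ n, Λ n ≠ z)
    (hsum : Summable fun n => e.repr u n * (starRingEnd ℂ) (e.repr v n) / (Λ n - z))
    {m : ℕ} (hm : e.repr v m ≠ 0) {g : H} (hg : perturbedOp e Λ hΛ u v g - z • g = e m) :
    1 + borelSeries e Λ u v z ≠ 0 := by
  have hz' : ∀ n, Λ n - z ≠ 0 := fun n => sub_ne_zero.2 (hz n)
  have hcoord : ∀ n, e.repr g n =
      (if n = m then 1 else 0) / (Λ n - z) - ⟪v, g⟫_ℂ * e.repr u n / (Λ n - z) := fun n => by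
    have := congrArg (fun h => e.repr h n) hg
    simp only [map_sub, map_smul, lp.coeFn_sub, Pi.sub_apply, lp.coeFn_smul, Pi.smul_apply,
      repr_perturbedOp, repr_basis, smul_eq_mul] at this
    rw [← this]
    field_simp [hz' n]
    ring
  have h1 := hasSum_conj_mul_repr e v g
  have h2 : HasSum (fun n => (starRingEnd ℂ) (e.repr v n) * e.repr g n)
      ((starRingEnd ℂ) (e.repr v m) / (Λ m - z) - ⟪v, g⟫_ℂ * borelSeries e Λ u v z) := by
    have h3 : HasSum (fun n => if n = m then (starRingEnd ℂ) (e.repr v m) / (Λ m - z) else 0) _ :=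
      hasSum_ite_eq m _
    refine (h3.sub (hsum.hasSum.mul_left ⟪v, g⟫_ℂ)).congr_fun fun n => ?_
    rw [hcoord]
    split_ifs with h
    · subst h; ring
    · ring
  have h4 := h1.unique h2
  intro h0
  have : (starRingEnd ℂ) (e.repr v m) / (Λ m - z) = 0 := by
    linear_combination ⟪v, g⟫_ℂ * h0 - h4
  rw [div_eq_zero_iff] at this
  exact this.elim (by simpa using hm) (hz' m)

/-- For a local solution `g` near `p`, the `n`-th coordinate at `z = Λ n`, `n ≠ m`, forces `⟪v, g z⟫
= 0`. These zeros accumulate at `p`, so the analytic function `⟪v, g z⟫` vanishes identically; then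
`g z` is a nonzero multiple of `e m`, which is not orthogonal to `v`. -/
theorem mem_localSpectrum_of_mem_derivedSet (e : HilbertBasis ℕ ℂ H) {Λ : ℕ → ℂ} {u v : H}
    (hRO : IsRO e Λ u v) {p : ℂ} (hp : p ∈ derivedSet (Set.range Λ)) (m : ℕ) :
    p ∈ localSpectrum (perturbedOp e Λ hRO.bounded u v) (e m) := by
  rintro ⟨U, ⟨hU, g, hg, hgz⟩, hpU⟩
  obtain ⟨r, hr, hball⟩ := Metric.isOpen_iff.1 hU p hpU
  have hcoord : ∀ z ∈ Metric.ball p r, ∀ n,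
      (Λ n - z) * e.repr (g z) n + ⟪v, g z⟫_ℂ * e.repr u n = if n = m then 1 else 0 := by
    intro z hz n
    have := congrArg (fun h => e.repr h n) (hgz z (hball hz))
    simp only [map_sub, map_smul, lp.coeFn_sub, Pi.sub_apply, lp.coeFn_smul, Pi.smul_apply,
      repr_perturbedOp, repr_basis, smul_eq_mul] at this
    rw [← this]
    ring
  have hu : ∀ n, e.repr u n ≠ 0 := fun n => left_ne_zero_of_mul (hRO.coeff_ne_zero n)
  have hv : ∀ n, e.repr v n ≠ 0 := fun n => right_ne_zero_of_mul (hRO.coeff_ne_zero n)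
  have han : AnalyticOnNhd ℂ (fun z => ⟪v, g z⟫_ℂ) (Metric.ball p r) :=
    DifferentiableOn.analyticOnNhd
      ((innerSL ℂ v).differentiable.comp_differentiableOn (hg.mono hball)) Metric.isOpen_ball
  have hfreq : ∃ᶠ z in 𝓝[≠] p, ⟪v, g z⟫_ℂ = 0 := by
    have h1 : ∃ᶠ z in 𝓝[≠] p, z ∈ Set.range Λ := accPt_iff_frequently_nhdsNE.1 hp
    have h2 : ∀ᶠ z in 𝓝[≠] p, z ∈ Metric.ball p r :=
      mem_nhdsWithin_of_mem_nhds (Metric.ball_mem_nhds p hr)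
    -- The index `m` must be avoided: there the right-hand coordinate is 1, not 0.
    have h3 : ∀ᶠ z in 𝓝[≠] p, z ≠ Λ m := by
      by_cases h : p = Λ m
      · subst h; exact self_mem_nhdsWithin
      · exact mem_nhdsWithin_of_mem_nhds (isOpen_ne.mem_nhds h)
    refine (h1.and_eventually (h2.and h3)).mono ?_
    rintro z ⟨⟨n, rfl⟩, hz, hne⟩
    have hnm : n ≠ m := fun h => hne (by rw [h])
    have := hcoord _ hz n
    simpa [hnm, hu n] using this
  have hzero := han.eqOn_zero_of_preconnected_of_frequently_eq_zero
    (convex_ball p r).isPreconnected (Metric.mem_ball_self hr) hfreq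
  obtain ⟨z, hz, hzΛ⟩ := ((Set.countable_range Λ).dense_compl ℂ).inter_open_nonempty
    (Metric.ball p r) Metric.isOpen_ball ⟨p, Metric.mem_ball_self hr⟩
  have hne : ∀ n, Λ n - z ≠ 0 := fun n h => hzΛ ⟨n, sub_eq_zero.1 h⟩
  have h0 : ⟪v, g z⟫_ℂ = 0 := hzero hz
  have hgz' : g z = (Λ m - z)⁻¹ • e m := by
    apply e.repr.injective
    ext n
    have := hcoord z hz n
    rw [h0, zero_mul, add_zero] at this
    rw [map_smul, lp.coeFn_smul, Pi.smul_apply, repr_basis, smul_eq_mul,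
      ← mul_right_inj' (hne n), this]
    split_ifs with h
    · subst h; field_simp [hne n]
    · simp
  rw [hgz', inner_smul_right, inner_basis_right] at h0
  exact (mul_ne_zero (inv_ne_zero (hne m)) (by simpa using hv m)) h0

/-- Off the derived set, `D_Λ - w` is boundedly invertible except possibly on one basis vector.
Injectivity of `T - w` is the absence of eigenvalues, and surjectivity is a rank-one computation. -/
theorem spectrum_subset_derivedSet [CompleteSpace H] (e : HilbertBasis ℕ ℂ H) {Λ : ℕ → ℂ} {u v : H}
    (hRO : IsRO e Λ u v) (hpT : pointSpectrum (perturbedOp e Λ hRO.bounded u v) = ∅) :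
    spectrum ℂ (perturbedOp e Λ hRO.bounded u v) ⊆ derivedSet (Set.range Λ) := by
  intro w hw
  by_contra hder
  set T := perturbedOp e Λ hRO.bounded u v with hT
  have hinj : ∀ h, T h - w • h = 0 → h = 0 := by
    intro h hh
    by_contra hne
    have : w ∈ pointSpectrum T := Module.End.hasEigenvalue_of_hasEigenvector (x := h)
      ⟨Module.End.mem_eigenspace_iff.2 (sub_eq_zero.1 hh), hne⟩
    simp [hpT] at this
  have hu : ∀ n, e.repr u n ≠ 0 := fun n => left_ne_zero_of_mul (hRO.coeff_ne_zero n)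
  have hv : ∀ n, e.repr v n ≠ 0 := fun n => right_ne_zero_of_mul (hRO.coeff_ne_zero n)
  obtain ⟨δ, hδ, hδ'⟩ : ∃ δ > 0, ∀ n, Λ n ≠ w → δ ≤ ‖Λ n - w‖ := by
    rw [mem_derivedSet, accPt_iff_frequently_nhdsNE, not_frequently, eventually_nhdsWithin_iff,
      Metric.eventually_nhds_iff] at hder
    obtain ⟨δ, hδ, h⟩ := hder
    refine ⟨δ, hδ, fun n hn => ?_⟩
    by_contra! hlt
    exact h (by rwa [dist_eq_norm]) hn ⟨n, rfl⟩
  have hb : Bornology.IsBounded (Set.range fun n => (Λ n - w)⁻¹) := by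
    refine isBounded_iff_forall_norm_le.2 ⟨δ⁻¹, ?_⟩
    rintro _ ⟨n, rfl⟩
    simp only [norm_inv]
    -- If `Λ n = w`, the convention `0⁻¹ = 0` makes this entry zero.
    by_cases hn : Λ n = w
    · simp [hn, hδ.le]
    · exact inv_anti₀ hδ (hδ' n hn)
  set R := diagonalOp e (fun n => (Λ n - w)⁻¹) hb with hR
  have hRr : ∀ h n, e.repr (R h) n = (Λ n - w)⁻¹ * e.repr h n := fun h n => repr_diagonalOp e _ hb h n
  have hsurj : ∀ h, ∃ g, T g - w • g = h := by
    intro h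
    by_cases hm : ∃ m, Λ m = w
    · obtain ⟨m, hm⟩ := hm
      -- The `m`-th coordinate forces `⟪v, g⟫ = c`. The other coordinates then determine `k`, and
      -- the free `e m` component is tuned by `t` to give the required inner product.
      set c := e.repr h m / e.repr u m with hc
      set k := R (h - c • u) with hk
      set t := (c - ⟪v, k⟫_ℂ) / (starRingEnd ℂ) (e.repr v m) with ht
      refine ⟨k + t • e m, ?_⟩
      have hin : ⟪v, k + t • e m⟫_ℂ = c := by
        have : (starRingEnd ℂ) (e.repr v m) ≠ 0 := by simpa using hv m
        rw [inner_add_right, inner_smul_right, inner_basis_right, ht]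
        field_simp
        ring
      apply e.repr.injective
      ext n
      rw [map_sub, lp.coeFn_sub, Pi.sub_apply, hT, repr_perturbedOp, hin]
      simp only [map_smul, lp.coeFn_smul, Pi.smul_apply, smul_eq_mul, map_add, lp.coeFn_add,
        Pi.add_apply, repr_basis]
      rw [hk, hRr]
      simp only [map_sub, map_smul, lp.coeFn_sub, Pi.sub_apply, lp.coeFn_smul, Pi.smul_apply,
        smul_eq_mul]
      by_cases hn : n = m
      · subst hn
        have := hu n
        simp [hm, hc]
        field_simp
      · have : Λ n - w ≠ 0 := fun h => hn (hRO.injective (by rw [hm, sub_eq_zero.1 h]))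
        simp only [hn, if_false]
        field_simp
        ring
    · push Not at hm
      have hRD : ∀ k, T (R k) - w • R k = k + ⟪v, R k⟫_ℂ • u := fun k => by
        apply e.repr.injective
        ext n
        have : Λ n - w ≠ 0 := sub_ne_zero.2 (hm n)
        simp only [map_sub, map_smul, lp.coeFn_sub, Pi.sub_apply, lp.coeFn_smul, Pi.smul_apply,
          smul_eq_mul, hT, repr_perturbedOp, map_add, lp.coeFn_add, Pi.add_apply, hRr]
        field_simp
        ring
      -- Otherwise `R u` would be in the kernel of `T - w`. The solution below is the
      -- Sherman-Morrison formula.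
      have h1 : 1 + ⟪v, R u⟫_ℂ ≠ 0 := by
        intro h0
        have h2 : R u = 0 := hinj _ (by
          rw [hRD]
          nth_rewrite 1 [← one_smul ℂ u]
          rw [← add_smul, h0, zero_smul])
        rw [h2, inner_zero_right, add_zero] at h0
        exact one_ne_zero h0
      refine ⟨R (h - (⟪v, R h⟫_ℂ / (1 + ⟪v, R u⟫_ℂ)) • u), ?_⟩
      rw [hRD, map_sub, map_smul, inner_sub_right, inner_smul_right, sub_add, ← sub_smul,
        sub_eq_self]
      convert zero_smul ℂ u
      field_simp
      ring
  refine hw ?_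
  have hbij : Function.Bijective (T - algebraMap ℂ (H →L[ℂ] H) w) := by
    have happ : ∀ h, (T - algebraMap ℂ (H →L[ℂ] H) w) h = T h - w • h := fun h => by
      simp [Algebra.algebraMap_eq_smul_one]
    refine ⟨(injective_iff_map_eq_zero _).2 fun h hh => hinj h (by rw [← happ, hh]), fun h => ?_⟩
    obtain ⟨g, hg⟩ := hsurj h
    exact ⟨g, by rw [happ, hg]⟩
  rw [spectrum.mem_resolventSet_iff, ← IsUnit.neg_iff, neg_sub]
  exact ContinuousLinearMap.isUnit_iff_bijective.2 hbij

/-! ### The Cauchy kernel as a sup-norm holomorphic function of its pole. -/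

/-- The bounded continuous function `y ↦ (iy - b)⁻¹` on the real line. -/
def lineKernel (b : ℂ) (hb : b.re ≠ 0) : ℝ →ᵇ ℂ :=
  ofNormedAddCommGroup (fun y : ℝ => -(b - y * I)⁻¹) (continuous_inv_sub_mul_I hb).neg |b.re|⁻¹
    fun y => by rw [norm_neg]; exact norm_inv_sub_mul_I_le hb y

theorem lineKernel_apply (b : ℂ) (hb : b.re ≠ 0) (y : ℝ) :
    lineKernel b hb y = -(b - y * I)⁻¹ := rfl

theorem norm_lineKernel_le (b : ℂ) (hb : b.re ≠ 0) : ‖lineKernel b hb‖ ≤ |b.re|⁻¹ :=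
  norm_ofNormedAddCommGroup_le _ (by positivity) _

theorem lineKernel_sub (b c : ℂ) (hb : b.re ≠ 0) (hc : c.re ≠ 0) :
    lineKernel b hb - lineKernel c hc = (b - c) • (lineKernel b hb * lineKernel c hc) := by
  ext y
  simp only [coe_sub, Pi.sub_apply, BoundedContinuousFunction.coe_smul, coe_mul, Pi.mul_apply, lineKernel_apply, smul_eq_mul]
  have h1 := sub_mul_I_ne_zero hb y
  have h2 := sub_mul_I_ne_zero hc y
  field_simp
  ring

/-- `lineKernel` extended by zero to all `b`. -/
def lineKernelExt (b : ℂ) : ℝ →ᵇ ℂ :=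
  open Classical in if hb : b.re ≠ 0 then lineKernel b hb else 0

theorem lineKernelExt_apply {b : ℂ} (hb : b.re ≠ 0) (y : ℝ) :
    lineKernelExt b y = -(b - y * I)⁻¹ := by
  rw [lineKernelExt, dif_pos hb, lineKernel_apply]

theorem norm_lineKernelExt_le (b : ℂ) : ‖lineKernelExt b‖ ≤ |b.re|⁻¹ := by
  rw [lineKernelExt]
  split_ifs with hb
  · exact norm_lineKernel_le b hb
  · simp

theorem lineKernelExt_sub {b c : ℂ} (hb : b.re ≠ 0) (hc : c.re ≠ 0) :
    lineKernelExt b - lineKernelExt c = (b - c) • (lineKernelExt b * lineKernelExt c) := by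
  simp only [lineKernelExt, dif_pos hb, dif_pos hc]
  exact lineKernel_sub b c hb hc

theorem eventually_re_ne_zero {c : ℂ} (hc : c.re ≠ 0) : ∀ᶠ b in 𝓝 c, b.re ≠ 0 :=
  Complex.continuous_re.continuousAt.eventually_ne hc

theorem continuousAt_lineKernelExt {c : ℂ} (hc : c.re ≠ 0) : ContinuousAt lineKernelExt c := by
  rw [ContinuousAt, tendsto_iff_norm_sub_tendsto_zero]
  have h1 : Tendsto (fun b : ℂ => ‖b - c‖ * (|b.re|⁻¹ * |c.re|⁻¹)) (𝓝 c)
      (𝓝 (‖c - c‖ * (|c.re|⁻¹ * |c.re|⁻¹))) := by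
    refine ContinuousAt.tendsto ?_
    have : ContinuousAt (fun b : ℂ => |b.re|⁻¹) c :=
      (Complex.continuous_re.abs.continuousAt).inv₀ (abs_ne_zero.2 hc)
    fun_prop
  rw [sub_self, norm_zero, zero_mul] at h1
  refine squeeze_zero' (Eventually.of_forall fun _ => norm_nonneg _) ?_ h1
  filter_upwards [eventually_re_ne_zero hc] with b hb
  rw [lineKernelExt_sub hb hc, norm_smul]
  gcongr
  refine (norm_mul_le _ _).trans ?_
  gcongr
  · exact norm_lineKernelExt_le b
  · exact norm_lineKernelExt_le c

/-- By the resolvent identity the slope is a product of two kernels. The derivative is in sup norm,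
so it passes through the bounded operator `lineTransform`. -/
theorem hasDerivAt_lineKernelExt {c : ℂ} (hc : c.re ≠ 0) :
    HasDerivAt lineKernelExt (lineKernelExt c * lineKernelExt c) c := by
  rw [hasDerivAt_iff_tendsto_slope]
  have h : Tendsto (fun b => lineKernelExt b * lineKernelExt c) (𝓝[≠] c)
      (𝓝 (lineKernelExt c * lineKernelExt c)) :=
    ((continuousAt_lineKernelExt hc).mul continuousAt_const).tendsto.mono_left nhdsWithin_le_nhds
  refine h.congr' ?_
  filter_upwards [(eventually_re_ne_zero hc).filter_mono nhdsWithin_le_nhds,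
    self_mem_nhdsWithin] with b hb hne
  rw [slope_def_module, lineKernelExt_sub hb hc, smul_smul,
    inv_mul_cancel₀ (sub_ne_zero.2 hne), one_smul]

/-! ### The vector-valued line integral and its intertwining relation. -/

theorem integrable_inv_mul_inv_mul {a b : ℂ} (ha : a.re ≠ 0) (hb : b.re ≠ 0) (ψ : ℝ →ᵇ ℂ) :
    Integrable fun y : ℝ => (a - y * I)⁻¹ * (b - y * I)⁻¹ * ψ y :=
  (integrable_inv_mul_inv ha hb).mul_bdd ψ.continuous.aestronglyMeasurable
    (Eventually.of_forall ψ.norm_coe_le_norm)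

theorem integral_norm_inv_mul_inv_mul_le {a b : ℂ} (ha : a.re ≠ 0) (hb : b.re ≠ 0) (ψ : ℝ →ᵇ ℂ) :
    ∫ y : ℝ, ‖(a - y * I)⁻¹ * (b - y * I)⁻¹ * ψ y‖ ≤
      Real.pi / (√|a.re| * √|b.re|) * ‖ψ‖ := by
  refine le_trans ?_ (mul_le_mul_of_nonneg_right (integral_norm_inv_mul_inv_le ha hb)
    (norm_nonneg ψ))
  rw [← integral_mul_const]
  refine integral_mono (integrable_inv_mul_inv_mul ha hb ψ).norm
    ((integrable_inv_mul_inv ha hb).norm.mul_const _) fun y => ?_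
  simp only
  rw [norm_mul _ (ψ y)]
  gcongr
  exact ψ.norm_coe_le_norm y

/-- The coefficient `α n` against the integral of `ψ (y) / ((a₀ - iy) (a n - iy))`. -/
def transformCoeff (α a : ℕ → ℂ) (a₀ : ℂ) (ψ : ℝ →ᵇ ℂ) (n : ℕ) : ℂ :=
  α n * ∫ y : ℝ, (a₀ - y * I)⁻¹ * (a n - y * I)⁻¹ * ψ y

theorem norm_transformCoeff_le {α a : ℕ → ℂ} {a₀ : ℂ} (ha : ∀ n, (a n).re ≠ 0) (ha₀ : a₀.re ≠ 0)
    (ψ : ℝ →ᵇ ℂ) (n : ℕ) :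
    ‖transformCoeff α a a₀ ψ n‖ ≤ ‖ψ‖ * ((Real.pi / √|a₀.re|) * (‖α n‖ / √|(a n).re|)) := by
  rw [transformCoeff, norm_mul]
  calc _ ≤ ‖α n‖ * (Real.pi / (√|a₀.re| * √|(a n).re|) * ‖ψ‖) :=
        mul_le_mul_of_nonneg_left ((norm_integral_le_integral_norm _).trans
          (integral_norm_inv_mul_inv_mul_le ha₀ (ha n) ψ)) (norm_nonneg _)
    _ = _ := by
        rw [← div_div]
        ring

theorem memlp_bound {α a : ℕ → ℂ} (hs : Summable fun n => ‖α n‖ ^ 2 / |(a n).re|) (c : ℝ) :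
    Memℓp (fun n => c * (‖α n‖ / √|(a n).re|)) 2 := by
  refine Memℓp.const_mul (f := fun n => ‖α n‖ / √|(a n).re|) (memℓp_gen ?_) c
  refine hs.congr fun n => ?_
  simp [div_pow]

theorem memlp_transformCoeff {α a : ℕ → ℂ} {a₀ : ℂ} (ha : ∀ n, (a n).re ≠ 0) (ha₀ : a₀.re ≠ 0)
    (hs : Summable fun n => ‖α n‖ ^ 2 / |(a n).re|) (ψ : ℝ →ᵇ ℂ) :
    Memℓp (transformCoeff α a a₀ ψ) 2 :=
  Memℓp.mono ((memlp_bound hs (Real.pi / √|a₀.re|)).const_mul ‖ψ‖)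
    (norm_transformCoeff_le ha ha₀ ψ)

/-- The bounded operator sending `ψ` to the vector `∫ (a₀ - iy)⁻¹ ψ(y) (A - iy)⁻¹ u dy`, where `A`
is the diagonal operator with entries `a` and `u` has coefficients `α`. -/
def lineTransform (e : HilbertBasis ℕ ℂ H) {α a : ℕ → ℂ} {a₀ : ℂ} (ha : ∀ n, (a n).re ≠ 0)
    (ha₀ : a₀.re ≠ 0) (hs : Summable fun n => ‖α n‖ ^ 2 / |(a n).re|) : (ℝ →ᵇ ℂ) →L[ℂ] H :=
  LinearMap.mkContinuous
    { toFun := fun ψ => e.repr.symm ⟨transformCoeff α a a₀ ψ, memlp_transformCoeff ha ha₀ hs ψ⟩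
      map_add' := fun ψ χ => by
        rw [← map_add]
        congr 1
        ext n
        simp only [lp.coeFn_add, Pi.add_apply, transformCoeff, coe_add, mul_add]
        rw [integral_add (integrable_inv_mul_inv_mul ha₀ (ha n) ψ)
          (integrable_inv_mul_inv_mul ha₀ (ha n) χ), mul_add]
      map_smul' := fun c ψ => by
        rw [RingHom.id_apply, ← map_smul]
        congr 1
        ext n
        simp only [lp.coeFn_smul, Pi.smul_apply, transformCoeff, BoundedContinuousFunction.coe_smul, smul_eq_mul]
        simp_rw [mul_left_comm _ c]
        rw [integral_const_mul, mul_left_comm] }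
    ‖(⟨_, memlp_bound hs (Real.pi / √|a₀.re|)⟩ : lp (fun _ : ℕ => ℝ) 2)‖
    (fun ψ => by
      change ‖e.repr.symm _‖ ≤ _
      rw [LinearIsometryEquiv.norm_map, mul_comm, ← norm_norm ψ, ← norm_smul]
      refine lp.norm_mono (by norm_num) fun n => ?_
      refine (norm_transformCoeff_le ha ha₀ ψ n).trans (le_of_eq ?_)
      rw [lp.coeFn_smul, Pi.smul_apply, smul_eq_mul, Real.norm_of_nonneg (by positivity)])

theorem repr_lineTransform (e : HilbertBasis ℕ ℂ H) {α a : ℕ → ℂ} {a₀ : ℂ}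
    (ha : ∀ n, (a n).re ≠ 0) (ha₀ : a₀.re ≠ 0) (hs : Summable fun n => ‖α n‖ ^ 2 / |(a n).re|)
    (ψ : ℝ →ᵇ ℂ) (n : ℕ) :
    e.repr (lineTransform e ha ha₀ hs ψ) n =
      α n * ∫ y : ℝ, (a₀ - y * I)⁻¹ * (a n - y * I)⁻¹ * ψ y := by
  simp [lineTransform, transformCoeff]

/-- The sum is continuous by the Weierstrass M-test and tends to 0 at infinity by dominated
convergence. So the reciprocal minus 1 is continuous and vanishes at infinity, hence is bounded. -/
theorem exists_boundedContinuous_inv {a c : ℕ → ℂ} (ha : ∀ n, (a n).re ≠ 0)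
    (hs : Summable fun n => ‖c n‖ / |(a n).re|)
    (hne : ∀ y : ℝ, 1 + ∑' n, c n / (a n - y * I) ≠ 0) :
    ∃ q : ℝ →ᵇ ℂ, ∀ y : ℝ, q y * (1 + ∑' n, c n / (a n - y * I)) = 1 := by
  have hbd : ∀ n (y : ℝ), ‖c n / (a n - y * I)‖ ≤ ‖c n‖ / |(a n).re| := fun n y => by
    rw [div_eq_mul_inv, norm_mul, div_eq_mul_inv]
    gcongr
    exact norm_inv_sub_mul_I_le (ha n) y
  have hcont : Continuous fun y : ℝ => 1 + ∑' n, c n / (a n - y * I) := by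
    refine continuous_const.add (continuous_tsum (fun n => ?_) hs hbd)
    simp_rw [div_eq_mul_inv]
    exact continuous_const.mul (continuous_inv_sub_mul_I (ha n))
  have hlim : Tendsto (fun y : ℝ => ∑' n, c n / (a n - y * I)) (cocompact ℝ) (𝓝 0) := by
    have := tendsto_tsum_of_dominated_convergence (𝓕 := cocompact ℝ)
      (f := fun (y : ℝ) n => c n / (a n - y * I)) (g := fun _ => 0) hs
      (fun n => by
        simp_rw [div_eq_mul_inv]
        simpa using (tendsto_inv_sub_mul_I (tendsto_norm_cocompact_atTop (E := ℝ))
          (a n)).const_mul (c n))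
      (Eventually.of_forall fun y n => hbd n y)
    simpa using this
  have hlim' : Tendsto (fun y : ℝ => (1 + ∑' n, c n / (a n - y * I))⁻¹ - 1) (cocompact ℝ)
      (𝓝 0) := by
    have := ((hlim.const_add 1).inv₀ (by simp)).sub_const 1
    simpa using this
  let q₀ : ZeroAtInftyContinuousMap ℝ ℂ :=
    ⟨⟨fun y : ℝ => (1 + ∑' n, c n / (a n - y * I))⁻¹ - 1, (hcont.inv₀ hne).sub continuous_const⟩,
      hlim'⟩
  refine ⟨q₀.toBCF + 1, fun y => ?_⟩
  have : (q₀.toBCF + 1) y = (1 + ∑' n, c n / (a n - y * I))⁻¹ - 1 + 1 := rfl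
  rw [this, sub_add_cancel, inv_mul_cancel₀ (hne y)]

/-- Sum and integral are interchanged, which makes the Borel series on the line appear. Absolute
convergence comes from `s * t ≤ s² + t²` with `s = |α_n| / √|Re a_n|` and `t = |β_n|`. -/
theorem inner_lineTransform (e : HilbertBasis ℕ ℂ H) (u v : H) {a : ℕ → ℂ} {a₀ : ℂ}
    (ha : ∀ n, (a n).re ≠ 0) (ha₀ : a₀.re ≠ 0)
    (hs : Summable fun n => ‖e.repr u n‖ ^ 2 / |(a n).re|) (χ : ℝ →ᵇ ℂ) :
    ⟪v, lineTransform e ha ha₀ hs χ⟫_ℂ = ∫ y : ℝ, (a₀ - y * I)⁻¹ * χ y *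
      ∑' n, e.repr u n * (starRingEnd ℂ) (e.repr v n) / (a n - y * I) := by
  have h1 := hasSum_conj_mul_repr e v (lineTransform e ha ha₀ hs χ)
  have hv2 : Summable fun n => ‖e.repr v n‖ ^ 2 := by
    simpa using (lp.memℓp (e.repr v)).summable (by norm_num)
  set F : ℕ → ℝ → ℂ := fun n y => (e.repr u n * (starRingEnd ℂ) (e.repr v n)) *
    ((a₀ - y * I)⁻¹ * (a n - y * I)⁻¹ * χ y) with hF
  have hFi : ∀ n, Integrable (F n) := fun n =>
    (integrable_inv_mul_inv_mul ha₀ (ha n) χ).const_mul _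
  have hFs : Summable fun n => ∫ y : ℝ, ‖F n y‖ := by
    refine Summable.of_nonneg_of_le (fun n => integral_nonneg fun y => norm_nonneg _) (fun n => ?_)
      ((hs.add hv2).mul_left (Real.pi / √|a₀.re| * ‖χ‖))
    simp_rw [hF, norm_mul (_ * _) (_ * _ * _)]
    rw [integral_const_mul, norm_mul, RCLike.norm_conj]
    have hA : 0 < √|(a n).re| := Real.sqrt_pos.2 (abs_pos.2 (ha n))
    have hA2 : |(a n).re| = √|(a n).re| ^ 2 := (Real.sq_sqrt (abs_nonneg _)).symm
    refine (mul_le_mul_of_nonneg_left (integral_norm_inv_mul_inv_mul_le ha₀ (ha n) χ)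
      (by positivity)).trans ?_
    calc _ = Real.pi / √|a₀.re| * ‖χ‖ * (‖e.repr u n‖ / √|(a n).re| * ‖e.repr v n‖) := by
          rw [← div_div]
          ring
      _ ≤ _ := by
          gcongr
          rw [show ‖e.repr u n‖ ^ 2 / |(a n).re| = (‖e.repr u n‖ / √|(a n).re|) ^ 2 by
            rw [div_pow, ← hA2]]
          nlinarith [two_mul_le_add_sq (‖e.repr u n‖ / √|(a n).re|) ‖e.repr v n‖,
            sq_nonneg (‖e.repr u n‖ / √|(a n).re|), sq_nonneg ‖e.repr v n‖]
  have h2 := hasSum_integral_of_summable_integral_norm hFi hFs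
  refine (h1.unique (h2.congr_fun fun n => ?_)).trans
    (integral_congr_ae (Eventually.of_forall fun y => ?_))
  · rw [repr_lineTransform]
    simp_rw [hF]
    rw [integral_const_mul]
    ring
  · simp only [hF]
    rw [← tsum_mul_left]
    exact tsum_congr fun n => by ring

/-- The resolvent identity in each coordinate leaves a multiple of `α_n` containing `q`. Since `q
f_T = 1 - q` on the line, the rank-one term cancels it and leaves an integral free of `q`. -/
theorem perturbedOp_lineTransform (e : HilbertBasis ℕ ℂ H) {Λ : ℕ → ℂ}
    (hΛ : Bornology.IsBounded (Set.range Λ)) (u v : H) {x : ℝ} {a₀ b : ℂ} (hb : b.re ≠ 0)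
    (ha : ∀ n, (Λ n - x).re ≠ 0) (ha₀ : a₀.re ≠ 0)
    (hs : Summable fun n => ‖e.repr u n‖ ^ 2 / |(Λ n - x).re|) {q : ℝ →ᵇ ℂ}
    (hq : ∀ y : ℝ, q y * (1 + ∑' n, e.repr u n * (starRingEnd ℂ) (e.repr v n) /
      (Λ n - x - y * I)) = 1) :
    perturbedOp e Λ hΛ u v (lineTransform e ha ha₀ hs (q * lineKernelExt b)) -
        (x + b) • lineTransform e ha ha₀ hs (q * lineKernelExt b) =
      lineTransform e ha ha₀ hs q - (∫ y : ℝ, (a₀ - y * I)⁻¹ * (b - y * I)⁻¹) • u := by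
  have hi : Integrable fun y : ℝ => (a₀ - y * I)⁻¹ * (b - y * I)⁻¹ := integrable_inv_mul_inv ha₀ hb
  have hi' : Integrable fun y : ℝ => (a₀ - y * I)⁻¹ * (b - y * I)⁻¹ * q y :=
    integrable_inv_mul_inv_mul ha₀ hb q
  have hin : ⟪v, lineTransform e ha ha₀ hs (q * lineKernelExt b)⟫_ℂ =
      (∫ y : ℝ, (a₀ - y * I)⁻¹ * (b - y * I)⁻¹ * q y) -
        ∫ y : ℝ, (a₀ - y * I)⁻¹ * (b - y * I)⁻¹ := by
    rw [inner_lineTransform, ← integral_sub hi' hi]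
    refine integral_congr_ae (Eventually.of_forall fun y => ?_)
    simp only [coe_mul, Pi.mul_apply, lineKernelExt_apply hb]
    linear_combination -(a₀ - y * I)⁻¹ * (b - y * I)⁻¹ * hq y
  apply e.repr.injective
  ext n
  rw [map_sub, lp.coeFn_sub, Pi.sub_apply, repr_perturbedOp, hin]
  simp only [map_sub, map_smul, lp.coeFn_sub, Pi.sub_apply, lp.coeFn_smul, Pi.smul_apply,
    smul_eq_mul, repr_lineTransform]
  have hcoord : (Λ n - x - b) * ∫ y : ℝ, (a₀ - y * I)⁻¹ * (Λ n - x - y * I)⁻¹ *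
        (q * lineKernelExt b) y =
      (∫ y : ℝ, (a₀ - y * I)⁻¹ * (Λ n - x - y * I)⁻¹ * q y) -
        ∫ y : ℝ, (a₀ - y * I)⁻¹ * (b - y * I)⁻¹ * q y := by
    rw [← integral_const_mul, ← integral_sub (integrable_inv_mul_inv_mul ha₀ (ha n) q) hi']
    refine integral_congr_ae (Eventually.of_forall fun y => ?_)
    simp only [coe_mul, Pi.mul_apply, lineKernelExt_apply hb]
    have h1 := sub_mul_I_ne_zero (ha n) y
    have h2 := sub_mul_I_ne_zero hb y
    have key : (Λ n - x - b) * ((Λ n - x - y * I)⁻¹ * (b - y * I)⁻¹) =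
        (b - y * I)⁻¹ - (Λ n - x - y * I)⁻¹ := by
      field_simp
      ring
    linear_combination -(a₀ - y * I)⁻¹ * q y * key
  linear_combination e.repr u n * hcoord

/-! ### Local resolvents and the splitting of a basis vector. -/

theorem exists_resolvent_solution [CompleteSpace H] {T : H →L[ℂ] H} {z : ℂ}
    (hz : z ∉ spectrum ℂ T) (h : H) :
    T (-resolvent T z h) - z • -resolvent T z h = h := by
  have h1 : IsUnit (algebraMap ℂ (H →L[ℂ] H) z - T) := spectrum.notMem_iff.1 hz
  have h2 : (algebraMap ℂ (H →L[ℂ] H) z - T) * resolvent T z = 1 := Ring.mul_inverse_cancel _ h1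
  have h3 := congrArg (fun A : H →L[ℂ] H => A h) h2
  simp only [mul_apply_eq_comp, _root_.sub_apply, Algebra.algebraMap_eq_smul_one, _root_.smul_apply,
    one_apply_eq_self] at h3
  rw [map_neg, smul_neg, sub_neg_eq_add, neg_add_eq_sub, h3]

theorem localSpectrum_subset_spectrum [CompleteSpace H] (T : H →L[ℂ] H) (h : H) :
    localSpectrum T h ⊆ spectrum ℂ T := by
  rw [localSpectrum, spectrum, Set.compl_subset_compl]
  refine Set.subset_sUnion_of_mem ⟨spectrum.isOpen_resolventSet T, fun z => -resolvent T z h,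
    fun z hz => ?_, fun z hz => exists_resolvent_solution (not_not_intro hz) h⟩
  exact (((ContinuousLinearMap.apply ℂ H h).differentiableAt.comp z
    (spectrum.hasDerivAt_resolvent_const_left hz).differentiableAt).neg).differentiableWithinAt

theorem localSpectrum_subset_of_solution [CompleteSpace H] {T : H →L[ℂ] H} {h : H} {U : Set ℂ}
    (hU : IsOpen U) {g : ℂ → H} (hg : DifferentiableOn ℂ g U)
    (hgz : ∀ z ∈ U, T (g z) - z • g z = h) : localSpectrum T h ⊆ spectrum ℂ T \ U :=
  fun _ hz => ⟨localSpectrum_subset_spectrum T h hz, fun hzU => hz ⟨U, ⟨hU, g, hg, hgz⟩, hzU⟩⟩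

theorem differentiableAt_lineTransform (e : HilbertBasis ℕ ℂ H) {α a : ℕ → ℂ} {a₀ : ℂ}
    (ha : ∀ n, (a n).re ≠ 0) (ha₀ : a₀.re ≠ 0) (hs : Summable fun n => ‖α n‖ ^ 2 / |(a n).re|)
    (q : ℝ →ᵇ ℂ) {x : ℝ} {w : ℂ} (hw : w.re ≠ x) :
    DifferentiableAt ℂ (fun w => lineTransform e ha ha₀ hs (q * lineKernelExt (w - x))) w := by
  have h1 : DifferentiableAt ℂ (fun w : ℂ => lineKernelExt (w - x)) w :=
    ((hasDerivAt_lineKernelExt (c := w - x)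
      (by simpa [sub_eq_zero] using hw)).comp_sub_const w (x : ℂ)).differentiableAt
  exact (lineTransform e ha ha₀ hs).differentiableAt.comp w (h1.const_mul q)

/-- If the coefficients of `u` and `v` are summable against the distance to the line `Re = x` and
`1 + f_T` does not vanish there, then a basis vector `e m` with `Re (Λ m) > x` splits along it. -/
theorem exists_add_eq_basis [CompleteSpace H] (e : HilbertBasis ℕ ℂ H) {Λ : ℕ → ℂ}
    (hΛ : Bornology.IsBounded (Set.range Λ)) (u v : H) {x : ℝ} (hx : ∀ n, (Λ n).re ≠ x)
    (hs : Summable fun n =>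
      ‖e.repr u n‖ ^ 2 / |(Λ n).re - x| + ‖e.repr v n‖ ^ 2 / |(Λ n).re - x|)
    (hf : ∀ y : ℝ, 1 + borelSeries e Λ u v ⟨x, y⟩ ≠ 0) {m : ℕ} (hm : x < (Λ m).re) :
    ∃ h₁ ∈ spectralSubspace (perturbedOp e Λ hΛ u v) (rightPart (perturbedOp e Λ hΛ u v) x),
    ∃ h₂ ∈ spectralSubspace (perturbedOp e Λ hΛ u v) (leftPart (perturbedOp e Λ hΛ u v) x),
      h₁ + h₂ = e m := by
  set T := perturbedOp e Λ hΛ u v with hT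
  have hre : ∀ n, (Λ n - x).re = (Λ n).re - x := fun n => by simp
  have ha : ∀ n, (Λ n - x).re ≠ 0 := fun n => by rw [hre]; exact sub_ne_zero.2 (hx n)
  have hm' : 0 < (Λ m - x).re := by rw [hre]; linarith
  have hsu : Summable fun n => ‖e.repr u n‖ ^ 2 / |(Λ n - x).re| := by
    simp_rw [hre]
    exact hs.of_nonneg_of_le (fun n => by positivity) fun n => le_add_of_nonneg_right (by positivity)
  have hsuv : Summable fun n =>
      ‖e.repr u n * (starRingEnd ℂ) (e.repr v n)‖ / |(Λ n - x).re| := by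
    simp_rw [hre]
    refine hs.of_nonneg_of_le (fun n => by positivity) fun n => ?_
    rw [norm_mul, RCLike.norm_conj, ← add_div]
    gcongr
    nlinarith [two_mul_le_add_sq ‖e.repr u n‖ ‖e.repr v n‖, sq_nonneg ‖e.repr u n‖,
      sq_nonneg ‖e.repr v n‖]
  have hz : ∀ y : ℝ, (⟨x, y⟩ : ℂ) = x + y * I := fun y => Complex.mk_eq_add_mul_I x y
  obtain ⟨q, hq⟩ := exists_boundedContinuous_inv ha hsuv fun y => by
    have := hf y
    simpa only [borelSeries, hz, sub_add_eq_sub_sub] using this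
  set K := lineTransform e ha hm'.ne' hsu with hK
  -- Chosen so that `c` times the residue `-2π / (Λ m - w)` cancels the multiple of `u` produced by
  -- `(Λ m - w)⁻¹ • e m` in `hTe`.
  set c : ℂ := (starRingEnd ℂ) (e.repr v m) / (2 * Real.pi) with hc
  have hπ : (Real.pi : ℂ) ≠ 0 := by exact_mod_cast Real.pi_ne_zero
  have hsol : ∀ w : ℂ, w.re ≠ x → T (K (q * lineKernelExt (w - x))) -
      w • K (q * lineKernelExt (w - x)) =
        K q - (∫ y : ℝ, (Λ m - x - y * I)⁻¹ * (w - x - y * I)⁻¹) • u := fun w hw => by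
    have := perturbedOp_lineTransform e hΛ u v (b := w - x) (by simpa [sub_eq_zero] using hw)
      ha hm'.ne' hsu hq
    rwa [add_sub_cancel] at this
  have hTe : ∀ w, Λ m ≠ w → T ((Λ m - w)⁻¹ • e m) - w • (Λ m - w)⁻¹ • e m =
      e m + ((starRingEnd ℂ) (e.repr v m) / (Λ m - w)) • u := fun w hw => by
    rw [map_smul, hT, perturbedOp_apply, diagonalOp_basis, inner_basis_right, smul_add, smul_comm w,
      add_sub_right_comm, ← smul_sub, ← sub_smul, inv_smul_smul₀ (sub_ne_zero.2 hw), smul_smul,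
      inv_mul_eq_div]
  refine ⟨e m - c • K q, ?_, c • K q, ?_, sub_add_cancel _ _⟩
  · have hne : ∀ w : ℂ, w.re < x → Λ m ≠ w := fun w hw h => by rw [h] at hm; linarith
    refine (localSpectrum_subset_of_solution (U := {w : ℂ | w.re < x})
      (g := fun w => (Λ m - w)⁻¹ • e m - c • K (q * lineKernelExt (w - x)))
      (isOpen_lt Complex.continuous_re continuous_const) (fun w hw => ?_) fun w hw => ?_).trans ?_
    · have h1 : DifferentiableAt ℂ (fun w : ℂ => (Λ m - w)⁻¹) w :=
        DifferentiableAt.fun_inv (by fun_prop) (sub_ne_zero.2 (hne w hw))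
      exact ((h1.smul_const (e m)).sub ((differentiableAt_lineTransform e ha hm'.ne' hsu q
        (ne_of_lt hw)).const_smul c)).differentiableWithinAt
    · have h1 := hTe w (hne w hw)
      have h2 := hsol w (ne_of_lt hw)
      rw [integral_inv_mul_inv_of_pos_of_neg hm' (by simpa using hw)] at h2
      have h3 : c * -(2 * Real.pi / (Λ m - x - (w - x))) =
          -((starRingEnd ℂ) (e.repr v m) / (Λ m - w)) := by
        have := sub_ne_zero.2 (hne w hw)
        rw [hc, sub_sub_sub_cancel_right]
        field_simp
      rw [map_sub, map_smul T c, smul_sub, smul_comm w c, sub_sub_sub_comm, h1, ← smul_sub, h2,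
        smul_sub, smul_smul, h3]
      module
    · rintro w ⟨hw, hwx⟩
      exact ⟨hw, not_lt.1 hwx⟩
  · refine (localSpectrum_subset_of_solution (U := {w : ℂ | x < w.re})
      (g := fun w => c • K (q * lineKernelExt (w - x)))
      (isOpen_lt continuous_const Complex.continuous_re) (fun w hw => ?_) fun w hw => ?_).trans ?_
    · exact ((differentiableAt_lineTransform e ha hm'.ne' hsu q
        (ne_of_gt hw)).const_smul c).differentiableWithinAt
    -- Here `w` and `Λ m` are on the same side, so the multiple of `u` vanishes and no correction is
    -- needed.
    · have h2 := hsol w (ne_of_gt hw)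
      rw [integral_inv_mul_inv_of_pos hm' (by simpa using hw), zero_smul, sub_zero] at h2
      rw [map_smul T c, smul_comm w c, ← smul_sub, h2]
    · rintro w ⟨hw, hwx⟩
      exact ⟨hw, not_lt.1 hwx⟩

end RankOnePerturbation

end

/-! ### Non-triviality of both spectral subspaces. -/

theorem mainTheorem5 {H : Type*} [NormedAddCommGroup H] [InnerProductSpace ℂ H] [CompleteSpace H]
    (e : HilbertBasis ℕ ℂ H) (Λ : ℕ → ℂ) (u v : H)
    (hRO : RankOnePerturbation.IsRO e Λ u v)
    (T : H →L[ℂ] H) (hT : T = RankOnePerturbation.perturbedOp e Λ hRO.bounded u v)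
    (hconn : IsConnected (spectrum ℂ T))
    (hline : ¬ ∃ c : ℝ, ∀ z ∈ spectrum ℂ T, z.re = c)
    (hpT : RankOnePerturbation.pointSpectrum T = ∅)
    (hpT' : RankOnePerturbation.pointSpectrum (ContinuousLinearMap.adjoint T) = ∅)
    (x : ℝ) (hx : x ∈ RankOnePerturbation.relevantSet e Λ hRO.bounded u v)
    (hf : ∀ y : ℝ, (⟨x, y⟩ : ℂ) ∈ spectrum ℂ T →
      1 + RankOnePerturbation.borelSeries e Λ u v ⟨x, y⟩ ≠ 0) :
    RankOnePerturbation.spectralSubspace T (RankOnePerturbation.rightPart T x) ≠ ⊥ ∧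
      RankOnePerturbation.spectralSubspace T (RankOnePerturbation.leftPart T x) ≠ ⊥ := by
  open RankOnePerturbation in
  subst hT
  obtain ⟨hxs, hlo, hhi, hne, hsum⟩ := hx
  have hvne : ∀ n, e.repr v n ≠ 0 := fun n => right_ne_zero_of_mul (hRO.coeff_ne_zero n)
  -- Non-vanishing is needed on the whole line; off the spectrum the resolvent supplies it, any
  -- basis vector serving as right-hand side.
  have hf' : ∀ y : ℝ, 1 + borelSeries e Λ u v ⟨x, y⟩ ≠ 0 := fun y => by
    by_cases hy : (⟨x, y⟩ : ℂ) ∈ spectrum ℂ (perturbedOp e Λ hRO.bounded u v)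
    · exact hf y hy
    · refine one_add_borelSeries_ne_zero e Λ hRO.bounded u v
        (fun n h => hne n (by rw [h])) ?_ (hvne 0) (exists_resolvent_solution hy (e 0))
      refine Summable.of_norm_bounded hsum fun n => ?_
      have hd : |(Λ n).re - x| ≤ ‖Λ n - ⟨x, y⟩‖ := by
        simpa using Complex.abs_re_le_norm (Λ n - ⟨x, y⟩)
      have hd0 : 0 < |(Λ n).re - x| := abs_pos.2 (sub_ne_zero.2 (hne n))
      rw [norm_div, norm_mul, RCLike.norm_conj, ← add_div]
      gcongr
      nlinarith [two_mul_le_add_sq ‖e.repr u n‖ ‖e.repr v n‖, sq_nonneg ‖e.repr u n‖,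
        sq_nonneg ‖e.repr v n‖]
  have hder := spectrum_subset_derivedSet e hRO hpT
  obtain ⟨_, ⟨p, hp, rfl⟩, hpx⟩ := exists_lt_of_lt_csSup ⟨x, hxs⟩ hhi
  obtain ⟨_, ⟨p', hp', rfl⟩, hpx'⟩ := exists_lt_of_csInf_lt ⟨x, hxs⟩ hlo
  obtain ⟨_, hm, ⟨m, rfl⟩⟩ : (({z : ℂ | x < z.re}) ∩ Set.range Λ).Nonempty :=
    mem_closure_iff.1 (derivedSet_subset_closure _ (hder hp)) _
      (isOpen_lt continuous_const Complex.continuous_re) hpx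
  obtain ⟨h₁, hh₁, h₂, hh₂, hadd⟩ := exists_add_eq_basis e hRO.bounded u v hne hsum hf' hm
  constructor
  -- With `h₁ = 0` the vector `e m` lies in the left subspace, although its local spectrum contains
  -- `p`, which is strictly to the right.
  · intro hbot
    rw [hbot, Submodule.mem_bot] at hh₁
    rw [hh₁, zero_add] at hadd
    rw [hadd] at hh₂
    exact absurd (hh₂ (mem_localSpectrum_of_mem_derivedSet e hRO (hder hp) m)).2 (not_le.2 hpx)
  · intro hbot
    rw [hbot, Submodule.mem_bot] at hh₂
    rw [hh₂, add_zero] at hadd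
    rw [hadd] at hh₁
    exact absurd (hh₁ (mem_localSpectrum_of_mem_derivedSet e hRO (hder hp') m)).2 (not_le.2 hpx')
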